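/- Let $k\ge 2$ and let $\mathcal S=(s_1,\dots,s_{k-1})\in\{0,1\}^{k-1}$. The string $\mathcal S$ generates a threshold graph on $k$ vertices: start with a single vertex and, for $i=1,\dots,k-1$, add a new vertex that is adjacent to all earlier vertices if $s_i=1$ (join) and to none of them if $s_i=0$ (union). Assume that this graph is connected (equivalently, $s_{k-1}=1$). Arrange the vertices in a line during the construction: a vertex added by a join is put at the left end of the current line, a vertex added by a union at the right end. Let $\mathcal L_T^{(k)}$ be the Laplacian matrix (degree matrix minus adjacency matrix) of the graph, with the vertices in the order of this line, and let $B\in\{0,1\}^{k\times p}$ be a binary matrix whose rows are indexed by the vertices in the same order. The pair $(\mathcal L_T^{(k)},B)$ is called controllable if the system $\dot x=-\mathcal L_T^{(k)}x+Bu(t)$ is controllable, i.e. if every initial state can be steered to every final state in some finite time by some input $u$. A \emph{succession} of $b\in\{0,1\}$ in a string is a maximal block of consecutive entries equal to $b$ that either starts at the first entry or has at least two entries. An \emph{essential substring} of $\mathcal S$ is an initial segment $\mathcal S'=(s_1,\dots,s_t)$ with $s_t=1$ such that $s_t$ is immediately preceded by a succession of $0$ in $\mathcal S$, or is the final entry of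 a succession of $1$ in $\mathcal S$. Its \emph{local control matrix} $\hat B(\mathcal S')\in\mathbb R^{(t+1)\times p}$ consists of the rows of $B$ that belong to the $t+1$ vertices of the graph generated by $\mathcal S'$, in the order of the line of vertices of that graph. Its \emph{local checking matrix} $C(\mathcal S')\in\mathbb R^{(t+1)\times m}$ is defined as follows, where $m$ is the number of entries of the last succession in $\mathcal S'$. Let $f_q$ be the $q$th standard unit vector $e_q$ of $\mathbb R^{t+1}$ and $\delta=1$ if the last succession of $\mathcal S'$ is a succession of $1$; let $f_q$ be the $q$th to last standard unit vector $e_{-q}$ and $\delta=0$ if it is a succession of $0$. For $1\le j\le m-1$ the $j$th column of $C(\mathcal S')$ is $f_1-f_{j+1}$. The $m$th column is $f_1-f_{m+1}$ if $\mathcal S'$ has only one succession, and is $(t+\delta-m)f_1-\sum_{q=m+1}^{t+\delta}f_q$ otherwise. Then $(\mathcal L_T^{(k)},B)$ is controllable if and only if, for every essential substring $\mathcal S'$ of $\mathcal S$, the $m\times p$ matrix $C(\mathcal S')^{T}\hat B(\mathcal S')$ has full row rank, i.e. rank $m$ (where $m$ depends on $\mathcal S'$). -/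

import Mathlib

open Matrix

namespace ThresholdControl

/-- The linear time-invariant system `x' = A x + B u` is controllable: every initial state can be
steered to every final state in some finite time `T > 0` by a (continuous) input. -/
def IsControllable {ι κ : Type*} [Fintype ι] [Fintype κ]
    (A : Matrix ι ι ℝ) (B : Matrix ι κ ℝ) : Prop :=
  ∀ x₀ x₁ : ι → ℝ, ∃ T : ℝ, 0 < T ∧ ∃ (u : ℝ → κ → ℝ) (x : ℝ → ι → ℝ),
    ContinuousOn u (Set.Icc 0 T) ∧ x 0 = x₀ ∧ x T = x₁ ∧
      ∀ t ∈ Set.Icc 0 T, HasDerivWithinAt x (A *ᵥ x t + B *ᵥ u t) (Set.Icc 0 T) t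

/-- The threshold graph generated by the binary string `s` of size `n`. Its `n + 1` vertices are
labelled `0, 1, …, n` in the order in which they are added; vertex `i + 1` is joined to all the
earlier vertices if the entry `s i` is `1` (`true`) and to none of them if it is `0` (`false`). -/
def thresholdGraph {n : ℕ} (s : Fin n → Bool) : SimpleGraph (Fin (n + 1)) where
  Adj u v := u ≠ v ∧ ∃ i : Fin n, s i = true ∧ max u v = i.succ
  symm := ⟨fun u v h => ⟨h.1.symm, by simpa only [max_comm] using h.2⟩⟩
  loopless := ⟨fun _ h => h.1 rfl⟩

instance {n : ℕ} (s : Fin n → Bool) : DecidableRel (thresholdGraph s).Adj :=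
  fun u v => inferInstanceAs (Decidable (u ≠ v ∧ ∃ i : Fin n, s i = true ∧ max u v = i.succ))

/-- The line of vertices obtained in the construction: a vertex is put at the left end of the
current line if it is added by a join (entry `1`) and at the right end if it is added by a union
(entry `0`). `lineOrder s q` is the vertex at position `q`, counted from the left from `0`. -/
def lineOrder : {n : ℕ} → (Fin n → Bool) → (Fin (n + 1) ≃ Fin (n + 1))
  | 0, _ => Equiv.refl _
  | n + 1, s =>
    let e : Fin (n + 1) ≃ Fin (n + 1) := lineOrder fun i : Fin n => s i.castSucc
    if s (Fin.last n) = true then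
      (finSuccEquiv (n + 1)).trans ((Equiv.optionCongr e).trans finSuccEquivLast.symm)
    else
      finSuccEquivLast.trans ((Equiv.optionCongr e).trans finSuccEquivLast.symm)

/-- The Laplacian matrix of the threshold graph generated by `s`, with rows and columns in the order
of the line of vertices. -/
def thresholdLaplacian {n : ℕ} (s : Fin n → Bool) : Matrix (Fin (n + 1)) (Fin (n + 1)) ℝ :=
  ((thresholdGraph s).lapMatrix ℝ).submatrix (lineOrder s) (lineOrder s)

/-- The entries `i, i + 1, …, j` of `s` form a succession of `b`: a maximal run of entries equal
to `b`, which has at least two entries unless it starts at the first entry of `s`. -/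
structure IsSuccession {n : ℕ} (s : Fin n → Bool) (b : Bool) (i j : Fin n) : Prop where
  le : i ≤ j
  eq : ∀ l : Fin n, i ≤ l → l ≤ j → s l = b
  left : ∀ l : Fin n, (l : ℕ) + 1 = i → s l ≠ b
  right : ∀ l : Fin n, (l : ℕ) = j + 1 → s l ≠ b
  lt : 0 < (i : ℕ) → i < j

/-- The entries `i, …, j` of `s` form the last succession of `s`, and it is a succession of `b`. -/
def IsLastSuccession {n : ℕ} (s : Fin n → Bool) (b : Bool) (i j : Fin n) : Prop :=
  IsSuccession s b i j ∧ ∀ b' i' j', IsSuccession s b' i' j' → i' ≤ i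

/-- The string `s` has exactly one succession. -/
def HasOneSuccession {n : ℕ} (s : Fin n → Bool) : Prop :=
  ∃! q : Fin n × Fin n, ∃ b, IsSuccession s b q.1 q.2

/-- The substring consisting of the first `m` entries of `s`. -/
def substring {n m : ℕ} (s : Fin n → Bool) (h : m ≤ n) : Fin m → Bool :=
  fun i => s (Fin.castLE h i)

/-- The first `m` entries of `s` form an essential substring of `s`: the last of them is a `1` that
is immediately preceded by a succession of `0` of `s`, or is the final entry of a succession of `1`
of `s`. -/
def IsEssential {n : ℕ} (s : Fin n → Bool) (m : ℕ) : Prop :=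
  ∃ t : Fin n, (t : ℕ) + 1 = m ∧ s t = true ∧
    ((∃ i j : Fin n, IsSuccession s false i j ∧ (j : ℕ) + 1 = t) ∨
      ∃ i : Fin n, IsSuccession s true i t)

/-- The standard unit vector of `ℝ^(n+1)` with its `1` at the `q`-th position from the left
(if `b = true`) or from the right (if `b = false`), counted from `1`. -/
def unitVec (n : ℕ) (b : Bool) (q : ℕ) : Fin (n + 1) → ℝ :=
  fun r => if (if b = true then (r : ℕ) + 1 = q else (r : ℕ) + q = n + 1) then 1 else 0

open Classical in
/-- The local checking matrix of the string `s` of size `n` whose last succession is a succession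
of `b` with `m` entries. -/
noncomputable def localCheckingMatrix {n : ℕ} (s : Fin n → Bool) (b : Bool) (m : ℕ) :
    Matrix (Fin (n + 1)) (Fin m) ℝ :=
  let δ : ℕ := if b = true then 1 else 0
  Matrix.of fun r c =>
    if (c : ℕ) + 1 < m then
      (unitVec n b 1 - unitVec n b (c + 2)) r
    else if HasOneSuccession s then
      (unitVec n b 1 - unitVec n b (m + 1)) r
    else
      (((n : ℝ) + δ - m) • unitVec n b 1 - ∑ q ∈ Finset.Icc (m + 1) (n + δ), unitVec n b q) r

/-- The local control matrix: the rows of `B` that belong to the vertices of the graph generated by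
the first `m` entries of `s`, in the order of the line of vertices of that smaller graph. -/
def localControlMatrix {n p m : ℕ} (s : Fin n → Bool) (h : m ≤ n)
    (B : Matrix (Fin (n + 1)) (Fin p) ℝ) : Matrix (Fin (m + 1)) (Fin p) ℝ :=
  B.submatrix
    (fun r => (lineOrder s).symm
      (Fin.castLE (Nat.add_le_add_right h 1) (lineOrder (substring s h) r))) id

/-- A nonempty string has a last succession. -/
theorem exists_isLastSuccession {n : ℕ} (hn : 0 < n) (s : Fin n → Bool) :
    ∃ b i j, IsLastSuccession s b i j := by
  classical
  let z : Fin n := ⟨0, hn⟩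
  let F : Finset (Fin n) := Finset.univ.filter fun j => ∀ l ≤ j, s l = s z
  have hF : F.Nonempty := ⟨z, by
    simp only [F, Finset.mem_filter, Finset.mem_univ, true_and]
    intro l hl
    have : l = z := Fin.ext (Nat.le_zero.mp hl)
    rw [this]⟩
  obtain ⟨j, hj⟩ := F.exists_maximal hF
  have hjF : ∀ l ≤ j, s l = s z := by simpa [F] using hj.1
  have hz : IsSuccession s (s z) z j := by
    refine ⟨Nat.zero_le _, fun l _ h => hjF l h, fun l h => ?_, fun l h hs => ?_, fun h => ?_⟩
    · exact absurd h (Nat.succ_ne_zero _)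
    · have hl : l ∈ F := by
        simp only [F, Finset.mem_filter, Finset.mem_univ, true_and]
        intro l' hl'
        rcases Nat.lt_or_ge j l' with h1 | h1
        · have : l' = l := Fin.ext (by have := Fin.le_def.mp hl'; omega)
          rw [this, hs]
        · exact hjF l' h1
      have := Fin.le_def.mp (hj.2 hl (Fin.le_def.mpr (by omega)))
      omega
    · exact absurd h (Nat.lt_irrefl 0)
  let G : Finset (Fin n) := Finset.univ.filter fun i => ∃ b j, IsSuccession s b i j
  have hG : G.Nonempty := ⟨z, by simp only [G, Finset.mem_filter, Finset.mem_univ, true_and]; exact ⟨_, _, hz⟩⟩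
  have hmem := G.max'_mem hG
  simp only [G, Finset.mem_filter, Finset.mem_univ, true_and] at hmem
  obtain ⟨b, j', h⟩ := hmem
  refine ⟨b, _, j', h, fun b' i' j'' h' => G.le_max' i' ?_⟩
  simp only [G, Finset.mem_filter, Finset.mem_univ, true_and]
  exact ⟨b', j'', h'⟩

/-- The last succession of a string is unique. -/
theorem IsLastSuccession.unique {n : ℕ} {s : Fin n → Bool} {b b' : Bool} {i i' j j' : Fin n}
    (h : IsLastSuccession s b i j) (h' : IsLastSuccession s b' i' j') :
    b = b' ∧ i = i' ∧ j = j' := by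
  have hi : i = i' := le_antisymm (h'.2 _ _ _ h.1) (h.2 _ _ _ h'.1)
  subst hi
  have hb : b = b' := (h.1.eq i le_rfl h.1.le).symm.trans (h'.1.eq i le_rfl h'.1.le)
  subst hb
  refine ⟨rfl, rfl, ?_⟩
  rcases lt_trichotomy j j' with hlt | heq | hlt
  · have := Fin.lt_def.mp hlt
    have hle := Fin.le_def.mp h.1.le
    exact absurd (h'.1.eq ⟨j + 1, by omega⟩ (Fin.le_def.mpr (by simp; omega))
      (Fin.le_def.mpr (by simp; omega))) (h.1.right _ rfl)
  · exact heq
  · have := Fin.lt_def.mp hlt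
    have hle := Fin.le_def.mp h'.1.le
    exact absurd (h.1.eq ⟨j' + 1, by omega⟩ (Fin.le_def.mpr (by simp; omega))
      (Fin.le_def.mpr (by simp; omega))) (h'.1.right _ rfl)

end ThresholdControl

open ThresholdControl

/-! For a symmetric system, controllability means that no nonzero eigenvector is orthogonal to all
columns of `B` (`isControllable_iff_of_isSymm`). The vectors `stepVector l`, together with the
constants, form an orthogonal eigenbasis of the threshold Laplacian, and two of them share an
eigenvalue only if the string is constant between their entries (`eq_of_runEigenvalue_eq`). Since
the string ends in 1, none of them has eigenvalue 0. Hence an eigenvector is either constant or a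
run vector of a single maximal run (`eigenvector_cases`), and all run vectors of a constant block
are eigenvectors (`IsRunVector.lapMatrix_mulVec`).

Read in vertex labels, the columns of the local checking matrix are a basis of the run vectors of a
succession, so the rank condition says that `B` kills no nonzero run vector
(`forall_isEssential_rank_iff`).

The rank conditions do not mention the constants or the one-entry runs after the start. Here
binarity enters: the condition for the first succession makes the rows of `B` at vertices 0 and 1
differ, and for a 0/1 matrix this settles both remaining cases. -/

/-! ### Controllability of symmetric systems -/

open NormedSpace in
-- Gramian argument: if the Gramian `W` is injective, it is onto, and an input of the form `B*
-- exp(-sA) w` steers as required. The kernel of `W` lies in an `A`-invariant subspace; were this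
-- subspace nonzero, symmetry would give it an eigenvector of `A` killed by `B*`.
theorem exists_steering_of_isSelfAdjoint {V U : Type*} [NormedAddCommGroup V]
    [InnerProductSpace ℝ V] [FiniteDimensional ℝ V] [NormedAddCommGroup U] [InnerProductSpace ℝ U]
    [FiniteDimensional ℝ U] {A : V →L[ℝ] V} (hA : IsSelfAdjoint A) (B : U →L[ℝ] V)
    (h : ∀ (μ : ℝ) (x : V), A x = μ • x → B.adjoint x = 0 → x = 0) (x₀ x₁ : V) :
    ∃ (u : ℝ → U) (x : ℝ → V), Continuous u ∧ x 0 = x₀ ∧ x 1 = x₁ ∧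
      ∀ t, HasDerivAt x (A (x t) + B (u t)) t := by
  set E : ℝ → V →L[ℝ] V := fun s => exp (s • (-A)) with hE
  have hEd : ∀ s, HasDerivAt E (E s * (-A)) s := fun s => hasDerivAt_exp_smul_const (𝕂 := ℝ) (-A) s
  have hEc : Continuous E := continuous_iff_continuousAt.2 fun s => (hEd s).continuousAt
  have hEs : ∀ s, IsSelfAdjoint (E s) := fun s =>
    IsSelfAdjoint.exp ((IsSelfAdjoint.all s).smul hA.neg)
  have hEsymm : ∀ s v w, inner ℝ (E s v) w = inner ℝ v (E s w) := fun s v w => by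
    rw [← ContinuousLinearMap.adjoint_inner_right, ← ContinuousLinearMap.star_eq_adjoint, (hEs s).star_eq]
  let N : Submodule ℝ V :=
    { carrier := {w | ∀ s ∈ Set.Icc (0 : ℝ) 1, B.adjoint (E s w) = 0}
      add_mem' := fun ha hb s hs => by rw [map_add, map_add, ha s hs, hb s hs, add_zero]
      zero_mem' := fun s _ => by rw [map_zero, map_zero]
      smul_mem' := fun c x hx s hs => by rw [map_smul, map_smul, hx s hs, smul_zero] }
  -- Differentiate `B* exp(-sA) w = 0` in `s`; one-sided derivatives suffice at the endpoints.
  have hNA : ∀ w ∈ N, A w ∈ N := by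
    intro w hw s hs
    have h1 : HasDerivAt (fun s => B.adjoint (E s w)) (B.adjoint ((E s * (-A)) w)) s :=
      B.adjoint.hasFDerivAt.comp_hasDerivAt s ((hEd s).clm_apply (hasDerivAt_const s w) |>.congr_deriv (by simp))
    have h2 : HasDerivWithinAt (fun s => B.adjoint (E s w)) 0 (Set.Icc 0 1) s :=
      (hasDerivWithinAt_const s _ (0 : U)).congr (fun y hy => hw y hy) (hw s hs)
    have h3 := (uniqueDiffOn_Icc (zero_lt_one' ℝ) s hs).eq_deriv _ h1.hasDerivWithinAt h2
    simpa using h3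
  have hE0 : E 0 = 1 := by simp [hE]
  have hN : N = ⊥ := by
    by_contra hne
    have hA' : (A : V →ₗ[ℝ] V).IsSymmetric := hA.isSymmetric
    have : Nontrivial N := Submodule.nontrivial_iff_ne_bot.2 hne
    obtain ⟨x, hx⟩ := (hA'.restrict_invariant hNA).hasEigenvalue_iSup_of_finiteDimensional.exists_hasEigenvector
    refine hx.2 (Subtype.ext (h _ _ (congrArg Subtype.val hx.apply_eq_smul) ?_))
    simpa [hE0] using x.2 0 (by simp)
  let G : ℝ → V →L[ℝ] V := fun s => E s ∘L B ∘L B.adjoint ∘L E s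
  have hGc : Continuous G := by fun_prop
  let W : V →L[ℝ] V := ∫ s in (0 : ℝ)..1, G s
  have hW : ∀ w, W w = ∫ s in (0 : ℝ)..1, G s w := fun w =>
    ContinuousLinearMap.intervalIntegral_apply (hGc.intervalIntegrable _ _) w
  have hWinj : Function.Injective (W : V →ₗ[ℝ] V) := by
    refine (injective_iff_map_eq_zero _).2 fun w hw => ?_
    have hw' : W w = 0 := hw
    have hq : ∀ s, inner ℝ w (G s w) = ‖B.adjoint (E s w)‖ ^ 2 := fun s => by
      simp only [G, ContinuousLinearMap.comp_apply]
      rw [← hEsymm, ← ContinuousLinearMap.adjoint_inner_left, real_inner_self_eq_norm_sq]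
    have hint : ∫ s in (0 : ℝ)..1, ‖B.adjoint (E s w)‖ ^ 2 = 0 := by
      have h1 := (innerSL ℝ w).intervalIntegral_comp_comm
        (((hGc.clm_apply continuous_const).intervalIntegrable (0 : ℝ) 1) :
          IntervalIntegrable (fun s => G s w) MeasureTheory.volume 0 1)
      rw [← hW, hw', map_zero] at h1
      simpa [hq] using h1
    have hmem : w ∈ N := by
      by_contra hcon
      obtain ⟨s, hs, hne⟩ : ∃ s ∈ Set.Icc (0 : ℝ) 1, B.adjoint (E s w) ≠ 0 := by
        by_contra! hall
        exact hcon hall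
      have := intervalIntegral.integral_pos (zero_lt_one' ℝ)
        (f := fun s => ‖B.adjoint (E s w)‖ ^ 2) (by fun_prop) (fun s _ => by positivity)
        ⟨s, hs, by positivity⟩
      exact this.ne' hint
    rwa [hN, Submodule.mem_bot] at hmem
  obtain ⟨w, hw⟩ := LinearMap.injective_iff_surjective.1 hWinj (E 1 x₁ - x₀)
  have hw' : ∫ s in (0 : ℝ)..1, G s w = E 1 x₁ - x₀ := by rw [← hW]; exact hw
  have hinv : ∀ (s : ℝ) (v : V), exp (s • A) (E s v) = v := fun s v => by
    have h1 : exp (s • A) * E s = 1 := by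
      rw [hE]
      simp only [smul_neg]
      let _ : NormedAlgebra ℚ (V →L[ℝ] V) := NormedAlgebra.restrictScalars ℚ ℝ _
      rw [← exp_add_of_commute (Commute.refl (s • A)).neg_right, add_neg_cancel, exp_zero]
    calc exp (s • A) (E s v) = (exp (s • A) * E s) v := rfl
      _ = v := by rw [h1]; rfl
  -- Variation of constants; the choice of `w` makes the bracket at time 1 equal to `exp(-A) x₁`.
  refine ⟨fun s => B.adjoint (E s w), fun t => exp (t • A) (x₀ + ∫ s in (0 : ℝ)..t, G s w),
    by fun_prop, ?_, ?_, fun t => ?_⟩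
  · simp
  · simp only [hw', add_sub_cancel, hinv]
  · have h1 : HasDerivAt (fun t : ℝ => exp (t • A)) (A * exp (t • A)) t :=
      hasDerivAt_exp_smul_const' (𝕂 := ℝ) A t
    have h2 : HasDerivAt (fun t => x₀ + ∫ s in (0 : ℝ)..t, G s w) (G t w) t :=
      ((hGc.clm_apply continuous_const).integral_hasStrictDerivAt 0 t).hasDerivAt.const_add x₀
    refine (h1.clm_apply h2).congr_deriv ?_
    simp only [G, ContinuousLinearMap.comp_apply, hinv]
    rfl

/-- Along every trajectory `exp(-μt) (w ⬝ᵥ x t)` is conserved. Steering from `0` to `w` then forces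
`w ⬝ᵥ w = 0`. -/
theorem eq_zero_of_isControllable {ι κ : Type*} [Fintype ι] [Fintype κ] {A : Matrix ι ι ℝ}
    {B : Matrix ι κ ℝ} (h : IsControllable A B) {μ : ℝ} {w : ι → ℝ} (hA : w ᵥ* A = μ • w)
    (hB : w ᵥ* B = 0) : w = 0 := by
  obtain ⟨T, hT, u, x, -, h0, h1, hx⟩ := h 0 w
  have hd : ∀ t ∈ Set.Icc (0 : ℝ) T, HasDerivWithinAt (fun t => Real.exp (-μ * t) * (w ⬝ᵥ x t)) 0
      (Set.Icc 0 T) t := by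
    intro t ht
    have hw : HasDerivWithinAt (fun t => w ⬝ᵥ x t) (μ * (w ⬝ᵥ x t)) (Set.Icc 0 T) t := by
      have h2 : HasDerivWithinAt (fun t => w ⬝ᵥ x t) (w ⬝ᵥ (A *ᵥ x t + B *ᵥ u t))
          (Set.Icc 0 T) t := by
        simp only [dotProduct]
        exact HasDerivWithinAt.fun_sum fun i _ =>
          ((hasDerivWithinAt_pi.1 (hx t ht)) i).const_mul (w i)
      rwa [dotProduct_add, dotProduct_mulVec, dotProduct_mulVec, hA, hB, zero_dotProduct, add_zero,
        smul_dotProduct, smul_eq_mul] at h2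
    have he : HasDerivWithinAt (fun t => Real.exp (-μ * t)) (Real.exp (-μ * t) * (-μ))
        (Set.Icc 0 T) t := by
      simpa using (((hasDerivAt_id t).const_mul (-μ)).exp).hasDerivWithinAt
    refine (he.mul hw).congr_deriv ?_
    ring
  have hconst := constant_of_has_deriv_right_zero (fun t ht => (hd t ht).continuousWithinAt)
    (fun t ht => ((hd t (Set.Ico_subset_Icc_self ht)).mono_of_mem_nhdsWithin
      (Icc_mem_nhdsGE_of_mem ht))) T ⟨hT.le, le_rfl⟩
  simp only [h0, h1, dotProduct_zero, mul_zero, mul_eq_zero, Real.exp_ne_zero, false_or] at hconst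
  exact dotProduct_self_eq_zero.1 hconst

/-- The Popov–Belevitch–Hautus test for a symmetric system. -/
theorem isControllable_iff_of_isSymm {ι κ : Type*} [Fintype ι] [Fintype κ] {A : Matrix ι ι ℝ}
    (hA : A.IsSymm) (B : Matrix ι κ ℝ) :
    IsControllable A B ↔ ∀ (μ : ℝ) (w : ι → ℝ), A *ᵥ w = μ • w → w ᵥ* B = 0 → w = 0 := by
  classical
  refine ⟨fun h μ w hw hB => eq_zero_of_isControllable h (μ := μ) ?_ hB, fun h x₀ x₁ => ?_⟩
  · rw [← hw, ← vecMul_transpose, hA]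
  · let A' := toEuclideanCLM (𝕜 := ℝ) A
    let B' := (toEuclideanLin B).toContinuousLinearMap
    have hA' : IsSelfAdjoint A' := by
      rw [isSelfAdjoint_iff, ← map_star]
      congr 1
    have hB' : ∀ w, WithLp.ofLp (B'.adjoint w) = WithLp.ofLp w ᵥ* B := by
      intro w
      have := toEuclideanLin_conjTranspose_eq_adjoint B
      have h2 : B'.adjoint w = (LinearMap.adjoint (toEuclideanLin B)) w := rfl
      rw [h2, ← this, conjTranspose_eq_transpose_of_trivial]
      simp [mulVec_transpose]
    obtain ⟨u, x, hu, h0, h1, hx⟩ := exists_steering_of_isSelfAdjoint hA' B' (fun μ w hw hB => by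
      refine (WithLp.ofLp_eq_zero 2).1 (h μ (WithLp.ofLp w) ?_ ?_)
      · simpa [A'] using congrArg WithLp.ofLp hw
      · rw [← hB', hB]; rfl) (WithLp.toLp 2 x₀) (WithLp.toLp 2 x₁)
    refine ⟨1, one_pos, fun t => WithLp.ofLp (u t), fun t => WithLp.ofLp (x t), ?_, ?_, ?_, ?_⟩
    · exact ((PiLp.continuous_ofLp 2 _).comp hu).continuousOn
    · simp [h0]
    · simp [h1]
    · intro t _
      have := (PiLp.hasFDerivAt_ofLp (𝕜 := ℝ) 2 (x t)).comp_hasDerivAt t (hx t)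
      refine this.hasDerivWithinAt.congr_deriv ?_
      simp only [map_add]
      rfl

/-! ### Run vectors are Laplacian eigenvectors -/

/-- The vectors that are constant on the first `a + 1` vertices, vanish beyond vertex `c + 1`, and
have zero sum. -/
structure IsRunVector {n : ℕ} (a c : ℕ) (u : Fin (n + 1) → ℝ) : Prop where
  const : ∀ v : Fin (n + 1), (v : ℕ) ≤ a → u v = u 0
  zero : ∀ v : Fin (n + 1), c + 1 < (v : ℕ) → u v = 0
  sum : ∑ v, u v = 0

/-- The number of joins that follow the entry `l`. -/
def joinsAfter {n : ℕ} (s : Fin n → Bool) (l : Fin n) : ℕ :=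
  (Finset.univ.filter fun x => l < x ∧ s x = true).card

/-- The Laplacian eigenvalue that belongs to the run of the entry `l`. -/
def runEigenvalue {n : ℕ} (s : Fin n → Bool) (l : Fin n) : ℕ :=
  (if s l = true then (l : ℕ) + 2 else 0) + joinsAfter s l

theorem lapMatrix_mulVec_eq_sum {V : Type*} [Fintype V] [DecidableEq V] (G : SimpleGraph V)
    [DecidableRel G.Adj] (u : V → ℝ) (v : V) :
    (G.lapMatrix ℝ *ᵥ u) v = ∑ w, if G.Adj v w then u v - u w else 0 := by
  rw [SimpleGraph.lapMatrix_mulVec_apply, G.degree_eq_sum_if_adj, Finset.sum_mul,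
    SimpleGraph.neighborFinset_eq_filter, Finset.sum_filter, ← Finset.sum_sub_distrib]
  refine Finset.sum_congr rfl fun w _ => ?_
  split_ifs <;> simp

/-- A vertex beyond `c + 1` sees either all of the support or none of it, and the entries sum to
zero. For a vertex up to `c + 1`, every later join beyond `c + 1` contributes `u v`, while the first
`c + 2` vertices act as a complete or an empty graph according to `b`. -/
theorem IsRunVector.lapMatrix_mulVec {n : ℕ} {s : Fin n → Bool} {b : Bool} {a c : Fin n}
    (hac : a ≤ c) (hb : ∀ l, a ≤ l → l ≤ c → s l = b) {u : Fin (n + 1) → ℝ}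
    (hu : IsRunVector a c u) :
    (thresholdGraph s).lapMatrix ℝ *ᵥ u = (runEigenvalue s c : ℝ) • u := by
  ext v
  have hac' := Fin.le_def.1 hac
  rw [lapMatrix_mulVec_eq_sum, Pi.smul_apply, smul_eq_mul]
  rcases lt_or_ge ((c : ℕ) + 1) v with hv | hv
  · obtain ⟨v', rfl⟩ := Fin.exists_succ_eq.2 (show v ≠ 0 by rintro rfl; simp at hv)
    rw [hu.zero _ hv, mul_zero]
    have : ∀ w, (if (thresholdGraph s).Adj v'.succ w then 0 - u w else 0) =
        (if s v' = true then -1 else 0) * u w := by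
      intro w
      rcases lt_or_ge ((c : ℕ) + 1) w with hw | hw
      · simp [hu.zero w hw]
      · have h1 : w < v'.succ := Fin.lt_def.2 (by omega)
        have h2 : (thresholdGraph s).Adj v'.succ w ↔ s v' = true := by
          simp only [thresholdGraph, max_eq_left h1.le, Fin.succ_inj]
          exact ⟨fun h => by obtain ⟨_, i, h3, rfl⟩ := h; exact h3, fun h => ⟨h1.ne', v', h, rfl⟩⟩
        simp only [h2]
        split_ifs <;> ring
    rw [Finset.sum_congr rfl fun w _ => this w, ← Finset.mul_sum, hu.sum, mul_zero]
  · have hterm : ∀ w, (if (thresholdGraph s).Adj v w then u v - u w else 0) =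
        (if b = true then (if (w : ℕ) ≤ c + 1 then u v else 0) - u w else 0) +
        (if (c : ℕ) + 1 < w ∧ ∃ i, s i = true ∧ w = i.succ then u v else 0) := by
      intro w
      rcases lt_or_ge ((c : ℕ) + 1) w with hw | hw
      · have h1 : v < w := Fin.lt_def.2 (by omega)
        have h2 : (thresholdGraph s).Adj v w ↔ ((c : ℕ) + 1 < w ∧ ∃ i, s i = true ∧ w = i.succ) := by
          simp only [thresholdGraph, max_eq_right h1.le, hw, true_and]
          exact ⟨fun h => h.2, fun h => ⟨h1.ne, h⟩⟩
        simp [h2, hu.zero w hw, not_le.2 hw]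
      · simp only [hw, not_lt.2 hw, false_and, if_false, if_true, add_zero]
        by_cases hvw : u v = u w
        · simp [hvw]
        · have h0 : v ≠ w := fun h => hvw (by rw [h])
          -- Only pairs with different values contribute. The later vertex of such a pair is added
          -- inside the run, so `b` decides the adjacency.
          have hm : (a : ℕ) < max (v : ℕ) w := by
            by_contra! hle
            exact hvw ((hu.const v (le_trans (le_max_left _ _) hle)).trans
              (hu.const w (le_trans (le_max_right _ _) hle)).symm)
          obtain ⟨i, hi⟩ := Fin.exists_succ_eq.2 (show max v w ≠ 0 by
            intro h
            have := congrArg Fin.val h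
            rw [Fin.coe_max] at this
            simp at this hm; omega)
          have hi' := congrArg Fin.val hi
          rw [Fin.coe_max, Fin.val_succ] at hi'
          have hsi : s i = b := hb i (Fin.le_def.2 (by omega)) (Fin.le_def.2 (by omega))
          have h2 : (thresholdGraph s).Adj v w ↔ b = true := by
            simp only [thresholdGraph, ← hi, Fin.succ_inj]
            exact ⟨fun h => by obtain ⟨_, j, h3, rfl⟩ := h; rw [← hsi, h3],
              fun h => ⟨h0, i, by rw [hsi, h], rfl⟩⟩
          simp only [h2]
    rw [Finset.sum_congr rfl fun w _ => hterm w, Finset.sum_add_distrib]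
    have h1 : ∑ w : Fin (n + 1), (if (w : ℕ) ≤ c + 1 then u v else 0) = ((c : ℝ) + 2) * u v := by
      rw [← Finset.sum_filter, Finset.sum_const, nsmul_eq_mul]
      have : (Finset.univ.filter fun w : Fin (n + 1) => (w : ℕ) ≤ c + 1) = Finset.Iic c.succ := by
        ext w; simp [Fin.le_def]
      rw [this, Fin.card_Iic, Fin.val_succ]
      push_cast; ring
    have h2 : ∑ w : Fin (n + 1), (if (c : ℕ) + 1 < w ∧ ∃ i, s i = true ∧ w = i.succ then u v else 0)
        = (joinsAfter s c : ℝ) * u v := by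
      rw [Fin.sum_univ_succ]
      simp only [Fin.val_zero, not_lt_zero, false_and, if_false, zero_add, Fin.val_succ,
        Fin.succ_inj, add_lt_add_iff_right]
      rw [← Finset.sum_filter, Finset.sum_const, nsmul_eq_mul, joinsAfter]
      congr 3
      ext x
      simp only [Finset.mem_filter, Finset.mem_univ, true_and, Fin.lt_def]
      exact and_congr_right fun _ => ⟨fun h => by obtain ⟨i, h3, rfl⟩ := h; exact h3,
        fun h => ⟨x, h, rfl⟩⟩
    have hsc : s c = b := hb c hac le_rfl
    rw [h2, runEigenvalue, hsc]
    cases b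
    · simp
    · simp only [if_true, Finset.sum_sub_distrib, h1, hu.sum]
      push_cast; ring

/-! ### Separation of the eigenvalues -/

theorem joinsAfter_eq_add {n : ℕ} (s : Fin n → Bool) {l l' : Fin n} (h : l < l') :
    joinsAfter s l = joinsAfter s l' +
      ((Finset.Ioc l l').filter fun x => s x = true).card := by
  rw [joinsAfter, joinsAfter, ← Finset.card_union_of_disjoint]
  · congr 1
    ext x
    simp only [Finset.mem_filter, Finset.mem_univ, true_and, Finset.mem_union, Finset.mem_Ioc]
    constructor
    · rintro ⟨h1, h2⟩
      rcases lt_or_ge l' x with h3 | h3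
      · exact Or.inl ⟨h3, h2⟩
      · exact Or.inr ⟨⟨h1, h3⟩, h2⟩
    · rintro (⟨h1, h2⟩ | ⟨⟨h1, -⟩, h2⟩)
      · exact ⟨h.trans h1, h2⟩
      · exact ⟨h1, h2⟩
  · rw [Finset.disjoint_left]
    intro x hx hx'
    simp only [Finset.mem_filter, Finset.mem_univ, true_and, Finset.mem_Ioc] at hx hx'
    exact absurd hx.1 (not_lt.2 hx'.1.2)

/-- The numbers of later joins differ by the count of joins in `(l, l']`, which is at most `l' - l`.
Equal eigenvalues force this count to be 0 if both entries are 0 and `l' - l` if both are 1; mixed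
entries are impossible by size. -/
theorem eq_of_runEigenvalue_eq {n : ℕ} {s : Fin n → Bool} {l l' : Fin n} (h : l < l')
    (he : runEigenvalue s l = runEigenvalue s l') {x : Fin n} (hx : l ≤ x) (hx' : x ≤ l') :
    s x = s l := by
  rw [runEigenvalue, runEigenvalue, joinsAfter_eq_add s h] at he
  have hcard : (Finset.Ioc l l').card = l' - l := Fin.card_Ioc l l'
  have hle := Finset.card_filter_le (Finset.Ioc l l') fun x => s x = true
  have hlt := Fin.lt_def.1 h
  rcases hx.eq_or_lt with rfl | hx
  · rfl
  have hmem : x ∈ Finset.Ioc l l' := Finset.mem_Ioc.2 ⟨hx, hx'⟩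
  cases h1 : s l <;> cases h2 : s l' <;> simp only [h1, h2, if_true, if_false, reduceCtorEq] at he
  · have h3 : ((Finset.Ioc l l').filter fun x => s x = true).card = 0 := by omega
    have := Finset.filter_eq_empty_iff.1 (Finset.card_eq_zero.1 h3) hmem
    simpa using this
  · omega
  · omega
  · have h3 : ((Finset.Ioc l l').filter fun x => s x = true).card = (Finset.Ioc l l').card := by
      omega
    exact Finset.card_filter_eq_iff.1 h3 x hmem

theorem runEigenvalue_ne_zero {n : ℕ} {s : Fin n → Bool} (hs : ∃ l : Fin n, (l : ℕ) + 1 = n ∧ s l = true)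
    (l : Fin n) : runEigenvalue s l ≠ 0 := by
  obtain ⟨t, ht, hst⟩ := hs
  rw [runEigenvalue]
  split_ifs with h
  · omega
  · have : 0 < joinsAfter s l := by
      refine Finset.card_pos.2 ⟨t, ?_⟩
      have h1 : l ≠ t := fun h' => h (h' ▸ hst)
      have h2 : (l : ℕ) ≠ t := fun h' => h1 (Fin.ext h')
      simp only [Finset.mem_filter, Finset.mem_univ, true_and]
      exact ⟨Fin.lt_def.2 (by omega), hst⟩
    omega

theorem exists_last_eq_true_of_connected {n : ℕ} (hn : 1 ≤ n) {s : Fin n → Bool}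
    (hs : (thresholdGraph s).Connected) : ∃ l : Fin n, (l : ℕ) + 1 = n ∧ s l = true := by
  have : Nontrivial (Fin (n + 1)) := Fin.nontrivial_iff_two_le.2 (by omega)
  obtain ⟨w, hw, i, hi, hm⟩ := hs.preconnected.exists_adj_of_nontrivial (Fin.last n)
  rw [max_eq_left (Fin.le_last w)] at hm
  refine ⟨i, ?_, hi⟩
  have := congrArg Fin.val hm
  simpa using this.symm

/-! ### The step vectors and orthogonality to them -/

/-- The vector `e₀ + ⋯ + e_l - (l + 1) e_{l + 1}`. -/
def stepVector {n : ℕ} (l : Fin n) : Fin (n + 1) → ℝ :=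
  fun v => if (v : ℕ) ≤ l then 1 else if (v : ℕ) = l + 1 then -((l : ℝ) + 1) else 0

theorem stepVector_dotProduct {n : ℕ} (l : Fin n) (u : Fin (n + 1) → ℝ) :
    stepVector l ⬝ᵥ u = (∑ v ∈ Finset.univ.filter fun v : Fin (n + 1) => (v : ℕ) ≤ l, u v) - ((l : ℝ) + 1) * u l.succ := by
  have : ∀ v, stepVector l v * u v = (if (v : ℕ) ≤ l then u v else 0) -
      (if v = l.succ then ((l : ℝ) + 1) * u v else 0) := by
    intro v
    simp only [stepVector, Fin.ext_iff, Fin.val_succ]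
    split_ifs <;> first | omega | ring
  rw [dotProduct, Finset.sum_congr rfl fun v _ => this v, Finset.sum_sub_distrib,
    Finset.sum_filter]
  simp

theorem isRunVector_stepVector {n : ℕ} (l : Fin n) : IsRunVector l l (stepVector l) := by
  refine ⟨fun v hv => by simp [stepVector, hv], fun v hv => ?_, ?_⟩
  · simp only [stepVector]
    rw [if_neg (by omega), if_neg (by omega)]
  · have := stepVector_dotProduct l (fun _ => (1 : ℝ))
    simp only [dotProduct, mul_one, Finset.sum_const, nsmul_eq_mul] at this
    rw [this]
    have h2 : (Finset.univ.filter fun w : Fin (n + 1) => (w : ℕ) ≤ l) = Finset.Iic l.castSucc := by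
      ext w; simp [Fin.le_def]
    rw [h2, Fin.card_Iic]
    simp

/-- Orthogonality to the step vector of `l` says that `u` at `l + 1` is the mean of its values at
`0, …, l`. -/
theorem eq_apply_zero_of_stepVector_dotProduct {n : ℕ} {u : Fin (n + 1) → ℝ} {a : ℕ}
    (h : ∀ l : Fin n, (l : ℕ) < a → stepVector l ⬝ᵥ u = 0) (v : Fin (n + 1)) (hv : (v : ℕ) ≤ a) :
    u v = u 0 := by
  induction hk : (v : ℕ) using Nat.strong_induction_on generalizing v with
  | _ k ih =>
    subst hk
    rcases Fin.eq_zero_or_eq_succ v with rfl | ⟨l, rfl⟩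
    · rfl
    · rw [Fin.val_succ] at hv
      have h1 := h l (by omega)
      rw [stepVector_dotProduct, Finset.sum_congr rfl (g := fun _ => u 0)] at h1
      · have h2 : (Finset.univ.filter fun w : Fin (n + 1) => (w : ℕ) ≤ l) =
            Finset.Iic l.castSucc := by
          ext w; simp [Fin.le_def]
        rw [h2, Finset.sum_const, Fin.card_Iic, nsmul_eq_mul] at h1
        simp only [Fin.val_castSucc, Nat.cast_add, Nat.cast_one] at h1
        have h3 : ((l : ℝ) + 1) * (u 0 - u l.succ) = 0 := by linarith
        rcases mul_eq_zero.1 h3 with h4 | h4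
        · exact absurd h4 (by positivity)
        · linarith
      · intro w hw
        simp only [Finset.mem_filter, Finset.mem_univ, true_and] at hw
        exact ih w (by rw [Fin.val_succ]; omega) w (by omega) rfl

/-- Going down from the full sum: if the partial sum up to `k + 1` vanishes, orthogonality turns it
into `(k + 2) u (k + 1) = 0`, so the partial sum up to `k` vanishes too. -/
theorem sum_le_eq_zero_of_stepVector_dotProduct {n : ℕ} {u : Fin (n + 1) → ℝ} {c : ℕ}
    (hsum : ∑ v, u v = 0) (h : ∀ l : Fin n, c < l → stepVector l ⬝ᵥ u = 0) (k : ℕ) (hk : c < k)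
    (hk' : k ≤ n) : ∑ v ∈ Finset.univ.filter fun v : Fin (n + 1) => (v : ℕ) ≤ k, u v = 0 := by
  induction hk' using Nat.decreasingInduction with
  | self => rw [← hsum]; congr 1; ext v; simp; omega
  | of_succ k hkn ih =>
    have h1 := h ⟨k, hkn⟩ hk
    rw [stepVector_dotProduct] at h1
    have h2 : (Finset.univ.filter fun v : Fin (n + 1) => (v : ℕ) ≤ k + 1) =
        insert (Fin.succ ⟨k, hkn⟩) (Finset.univ.filter fun v : Fin (n + 1) => (v : ℕ) ≤ k) := by
      ext v; simp [Fin.ext_iff]; omega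
    have h3 := ih (by omega)
    rw [h2, Finset.sum_insert (by simp)] at h3
    simp only at h1
    have h4 : ((k : ℝ) + 2) * u (Fin.succ ⟨k, hkn⟩) = 0 := by linarith
    rcases mul_eq_zero.1 h4 with h5 | h5
    · exact absurd h5 (by positivity)
    · linarith

theorem apply_eq_zero_of_stepVector_dotProduct {n : ℕ} {u : Fin (n + 1) → ℝ} {c : ℕ}
    (hsum : ∑ v, u v = 0) (h : ∀ l : Fin n, c < l → stepVector l ⬝ᵥ u = 0) (v : Fin (n + 1))
    (hv : c + 1 < v) : u v = 0 := by
  obtain ⟨l, rfl⟩ := Fin.exists_succ_eq.2 (show v ≠ 0 by rintro rfl; simp at hv)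
  rw [Fin.val_succ] at hv
  have h1 := h l (by omega)
  rw [stepVector_dotProduct, sum_le_eq_zero_of_stepVector_dotProduct hsum h l (by omega) l.2.le]
    at h1
  have h3 : ((l : ℝ) + 1) * u l.succ = 0 := by linarith
  exact (mul_eq_zero.1 h3).resolve_left (by positivity)

theorem stepVector_dotProduct_eigenvector {n : ℕ} {s : Fin n → Bool} {u : Fin (n + 1) → ℝ} {μ : ℝ}
    (hu : (thresholdGraph s).lapMatrix ℝ *ᵥ u = μ • u) (l : Fin n) :
    stepVector l ⬝ᵥ u = 0 ∨ (runEigenvalue s l : ℝ) = μ := by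
  have h1 := (isRunVector_stepVector l).lapMatrix_mulVec (s := s) (b := s l) le_rfl
    (fun x h h' => by rw [le_antisymm h' h])
  have h2 : stepVector l ⬝ᵥ ((thresholdGraph s).lapMatrix ℝ *ᵥ u) =
      ((thresholdGraph s).lapMatrix ℝ *ᵥ stepVector l) ⬝ᵥ u := by
    rw [dotProduct_mulVec, ← mulVec_transpose, (SimpleGraph.isSymm_lapMatrix ℝ _).eq]
  rw [h1, hu, dotProduct_smul, smul_dotProduct, smul_eq_mul, smul_eq_mul] at h2
  have h3 : (stepVector l ⬝ᵥ u) * ((runEigenvalue s l : ℝ) - μ) = 0 := by linarith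
  rcases mul_eq_zero.1 h3 with h | h
  · exact Or.inl h
  · exact Or.inr (by linarith)

theorem sum_eq_zero_of_eigenvector {V : Type*} [Fintype V] [DecidableEq V] (G : SimpleGraph V)
    [DecidableRel G.Adj] {u : V → ℝ} {μ : ℝ} (hμ : μ ≠ 0)
    (hu : G.lapMatrix ℝ *ᵥ u = μ • u) : ∑ v, u v = 0 := by
  have h1 : (fun _ => (1 : ℝ)) ⬝ᵥ (G.lapMatrix ℝ *ᵥ u) = 0 := by
    rw [dotProduct_mulVec, ← mulVec_transpose, (G.isSymm_lapMatrix ℝ).eq,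
      G.lapMatrix_mulVec_const_eq_zero, zero_dotProduct]
  rw [hu, dotProduct_smul, smul_eq_mul] at h1
  simpa [dotProduct] using (mul_eq_zero.1 h1).resolve_left hμ

/-! ### Maximal runs and successions -/

theorem exists_maximal_run {n : ℕ} (s : Fin n → Bool) (l : Fin n) :
    ∃ a c : Fin n, a ≤ l ∧ l ≤ c ∧ (∀ x, a ≤ x → x ≤ c → s x = s l) ∧
      (∀ x : Fin n, (x : ℕ) + 1 = a → s x ≠ s l) ∧ ∀ x : Fin n, (x : ℕ) = c + 1 → s x ≠ s l := by
  classical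
  let F := Finset.univ.filter fun a => a ≤ l ∧ ∀ x, a ≤ x → x ≤ l → s x = s l
  let G := Finset.univ.filter fun c => l ≤ c ∧ ∀ x, l ≤ x → x ≤ c → s x = s l
  have hl : ∀ x, l ≤ x → x ≤ l → s x = s l := fun x h h' => by rw [le_antisymm h' h]
  have hF : F.Nonempty := ⟨l, by simpa [F] using hl⟩
  have hG : G.Nonempty := ⟨l, by simpa [G] using hl⟩
  have ha := F.min'_mem hF
  have hc := G.max'_mem hG
  have hmin : ∀ x ∈ F, F.min' hF ≤ x := fun x hx => F.min'_le x hx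
  have hmax : ∀ x ∈ G, x ≤ G.max' hG := fun x hx => G.le_max' x hx
  generalize F.min' hF = a at *
  generalize G.max' hG = c at *
  simp only [F, G, Finset.mem_filter, Finset.mem_univ, true_and] at ha hc hmin hmax
  refine ⟨a, c, ha.1, hc.1, fun x h h' => ?_, fun x hx hs => ?_, fun x hx hs => ?_⟩
  · rcases le_total x l with h1 | h1
    · exact ha.2 x h h1
    · exact hc.2 x h1 h'
  · have h1 := Fin.le_def.1 ha.1
    have := Fin.le_def.1 (hmin x ⟨Fin.le_def.2 (by omega), fun y hy hy' => ?_⟩)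
    · omega
    · rcases eq_or_ne y x with rfl | hne
      · exact hs
      · have h2 := Fin.le_def.1 hy
        have h3 : (y : ℕ) ≠ x := fun h => hne (Fin.ext h)
        exact ha.2 y (Fin.le_def.2 (by omega)) hy'
  · have h1 := Fin.le_def.1 hc.1
    have := Fin.le_def.1 (hmax x ⟨Fin.le_def.2 (by omega), fun y hy hy' => ?_⟩)
    · omega
    · rcases eq_or_ne y x with rfl | hne
      · exact hs
      · have h2 := Fin.le_def.1 hy'
        have h3 : (y : ℕ) ≠ x := fun h => hne (Fin.ext h)
        exact hc.2 y hy (Fin.le_def.2 (by omega))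

theorem exists_isSuccession_zero {n : ℕ} (hn : 0 < n) (s : Fin n → Bool) :
    ∃ (b : Bool) (a c : Fin n), (a : ℕ) = 0 ∧ IsSuccession s b a c := by
  obtain ⟨a, c, h1, h2, h3, h4, h5⟩ := exists_maximal_run s ⟨0, hn⟩
  have ha : (a : ℕ) = 0 := Nat.le_zero.1 (Fin.le_def.1 h1)
  exact ⟨_, a, c, ha, h1.trans h2, h3, h4, h5, fun h => by omega⟩

/-- The initial run is a succession whatever its length, so a unique succession must start at entry
0. -/
theorem ThresholdControl.IsLastSuccession.hasOneSuccession_iff {n : ℕ} {s : Fin n → Bool} {b : Bool} {i j : Fin n}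
    (h : IsLastSuccession s b i j) : HasOneSuccession s ↔ (i : ℕ) = 0 := by
  constructor
  · intro h1
    obtain ⟨b', a, c, ha, hac⟩ := exists_isSuccession_zero (lt_of_le_of_lt (Nat.zero_le _) i.2) s
    have := h1.unique (y₁ := (i, j)) (y₂ := (a, c)) ⟨b, h.1⟩ ⟨b', hac⟩
    rw [show i = a from congrArg Prod.fst this, ha]
  · intro hi
    refine ⟨(i, j), ⟨b, h.1⟩, ?_⟩
    rintro ⟨i', j'⟩ ⟨b', h'⟩
    have hle := h.2 _ _ _ h'
    have hii : i' = i := le_antisymm hle (Fin.le_def.2 (by omega))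
    obtain ⟨-, -, h3⟩ := h.unique (⟨h', fun b'' i'' j'' h'' => hii ▸ h.2 _ _ _ h''⟩ :
      IsLastSuccession s b' i' j')
    rw [hii, h3]

/-- At most one entry follows `j`, too few for another succession, since one that does not start the
string has at least two entries. -/
theorem ThresholdControl.IsSuccession.isLastSuccession_substring {n m : ℕ} {s : Fin n → Bool} (h : m ≤ n) {b : Bool}
    {i j : Fin m} (hij : IsSuccession s b (Fin.castLE h i) (Fin.castLE h j))
    (hm : m ≤ (j : ℕ) + 2) : IsLastSuccession (substring s h) b i j := by
  refine ⟨⟨hij.le, fun l h1 h2 => hij.eq _ h1 h2, fun l hl => hij.left _ hl,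
    fun l hl => hij.right _ hl, hij.lt⟩, fun b' i' j' h' => ?_⟩
  by_contra! hlt
  have hlt' := Fin.lt_def.1 hlt
  have hle' := Fin.le_def.1 h'.le
  rcases le_or_gt i' j with h1 | h1
  · have h2 : s (Fin.castLE h i') = b := hij.eq _ hlt.le h1
    have h3 : b' = b := (h'.eq i' le_rfl h'.le).symm.trans h2
    have h1' := Fin.le_def.1 h1
    refine h'.left ⟨i' - 1, by omega⟩ (by simp; omega) ?_
    rw [h3]
    exact hij.eq (Fin.castLE h ⟨i' - 1, by omega⟩) (Fin.le_def.2 (by simp; omega))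
      (Fin.le_def.2 (by simp; omega))
  · have h2 := Fin.lt_def.1 h1
    have h3 := Fin.lt_def.1 (h'.lt (by omega))
    omega

/-! ### Positions of vertices in the line -/

section lineOrder

variable {n : ℕ} (s : Fin (n + 1) → Bool)

theorem lineOrder_symm_last :
    ((lineOrder s).symm (Fin.last (n + 1)) : ℕ) = if s (Fin.last n) = true then 0 else n + 1 := by
  split_ifs with h
  · have : (lineOrder s).symm (Fin.last (n + 1)) = 0 := by
      rw [Equiv.symm_apply_eq, lineOrder]
      simp [h]
    rw [this]; rfl
  · have : (lineOrder s).symm (Fin.last (n + 1)) = Fin.last (n + 1) := by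
      rw [Equiv.symm_apply_eq, lineOrder]
      simp [h]
    rw [this]; rfl

theorem lineOrder_symm_castSucc (v : Fin (n + 1)) :
    ((lineOrder s).symm v.castSucc : ℕ) =
      (lineOrder fun i : Fin n => s i.castSucc).symm v + if s (Fin.last n) = true then 1 else 0 := by
  split_ifs with h
  · have : (lineOrder s).symm v.castSucc =
        ((lineOrder fun i : Fin n => s i.castSucc).symm v).succ := by
      rw [Equiv.symm_apply_eq, lineOrder]
      simp [h]
    rw [this]; rfl
  · have : (lineOrder s).symm v.castSucc =
        ((lineOrder fun i : Fin n => s i.castSucc).symm v).castSucc := by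
      rw [Equiv.symm_apply_eq, lineOrder]
      simp [h]
    rw [this]; rfl

end lineOrder

/-- Later vertices have exact positions. For the first `a + 1` only the block they fill matters,
since run vectors are constant there. -/
theorem lineOrder_symm_of_forall_eq_true {n : ℕ} {s : Fin n → Bool} {a : ℕ} (ha : a ≤ n)
    (h : ∀ l : Fin n, a ≤ l → s l = true) (v : Fin (n + 1)) :
    if (v : ℕ) ≤ a then n ≤ (lineOrder s).symm v + a else ((lineOrder s).symm v : ℕ) + v = n := by
  induction n with
  | zero =>
    have := v.2
    rw [if_pos (by omega)]
    omega
  | succ n ih =>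
    rcases ha.eq_or_lt with rfl | ha
    · rw [if_pos (by omega)]
      omega
    · have hl : s (Fin.last n) = true := h _ (by simp; omega)
      induction v using Fin.lastCases with
      | last =>
        rw [lineOrder_symm_last, if_pos hl, Fin.val_last, if_neg (by omega)]
        omega
      | cast v =>
        rw [lineOrder_symm_castSucc, if_pos hl, Fin.val_castSucc]
        have := ih (s := fun i : Fin n => s i.castSucc) (by omega) (fun l hl => h _ hl) v
        split_ifs at this ⊢ <;> omega

theorem lineOrder_symm_of_forall_eq_false {n : ℕ} {s : Fin n → Bool} {a : ℕ} (ha : a ≤ n)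
    (h : ∀ l : Fin n, a ≤ l → s l = false) (v : Fin (n + 1)) :
    if (v : ℕ) ≤ a then ((lineOrder s).symm v : ℕ) ≤ a else ((lineOrder s).symm v : ℕ) = v := by
  induction n with
  | zero =>
    have := v.2
    have := ((lineOrder s).symm v).2
    rw [if_pos (by omega)]
    omega
  | succ n ih =>
    rcases ha.eq_or_lt with rfl | ha
    · rw [if_pos (by omega)]
      omega
    · have hl : ¬ s (Fin.last n) = true := by simp [h (Fin.last n) (by simp; omega)]
      induction v using Fin.lastCases with
      | last =>
        rw [lineOrder_symm_last, if_neg hl, Fin.val_last, if_neg (by omega)]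
      | cast v =>
        rw [lineOrder_symm_castSucc, if_neg hl, Fin.val_castSucc]
        have := ih (s := fun i : Fin n => s i.castSucc) (by omega) (fun l hl => h _ hl) v
        split_ifs at this ⊢ <;> omega

/-! ### The local checking matrix in vertex labels -/

/-- `s` ends with a succession of `1`, or with a succession of `0` and a single `1`; the succession
consists of the entries `a, …, c` and equals `b`. -/
structure IsTail {n : ℕ} (s : Fin n → Bool) (b : Bool) (a c : Fin n) : Prop where
  le : a ≤ c
  eq : ∀ l : Fin n, a ≤ l → l ≤ c → s l = b
  length : n = if b = true then (c : ℕ) + 1 else c + 2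
  last : ∀ l : Fin n, (l : ℕ) = c + 1 → s l = true

namespace IsTail

variable {n : ℕ} {s : Fin n → Bool} {b : Bool} {a c : Fin n} (h : IsTail s b a c)
include h

theorem lineOrder_symm (v : Fin (n + 1)) :
    if b = true then
      (if (v : ℕ) ≤ a then n ≤ (lineOrder s).symm v + a else ((lineOrder s).symm v : ℕ) + v = n)
    else
      (if (v : ℕ) ≤ a then
          1 ≤ ((lineOrder s).symm v : ℕ) ∧ ((lineOrder s).symm v : ℕ) ≤ a + 1
        else if (v : ℕ) ≤ c + 1 then ((lineOrder s).symm v : ℕ) = v + 1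
        else ((lineOrder s).symm v : ℕ) = 0) := by
  have hac := Fin.le_def.1 h.le
  have hlen := h.length
  by_cases hb : b = true
  · rw [if_pos hb] at hlen ⊢
    exact lineOrder_symm_of_forall_eq_true a.2.le
      (fun l hl => hb ▸ h.eq l hl (Fin.le_def.2 (by omega))) v
  · rw [if_neg hb] at hlen ⊢
    obtain ⟨k, rfl⟩ : ∃ k, n = k + 1 := ⟨c + 1, hlen⟩
    have hl : s (Fin.last k) = true := h.last _ (by simp; omega)
    induction v using Fin.lastCases with
    | last =>
      rw [lineOrder_symm_last, if_pos hl, Fin.val_last, if_neg (by omega), if_neg (by omega)]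
    | cast v =>
      rw [lineOrder_symm_castSucc, if_pos hl, Fin.val_castSucc]
      have := lineOrder_symm_of_forall_eq_false (s := fun i : Fin k => s i.castSucc) (a := a)
        (by omega) (fun l hl => by
          rw [h.eq l.castSucc hl (Fin.le_def.2 (by simp; omega))]
          simpa using hb) v
      split_ifs at this ⊢ <;> omega

/-- For both values of `b`, the `q`th unit vector sits at vertex `c + 2 - q`, counting back from the
last vertex of the run. When `b` is 0, the final join is at the left end, away from the end where
counting starts. -/
theorem unitVec_lineOrder_symm {q : ℕ} (hq : 1 ≤ q) (hq' : q + a ≤ c + 1) (v : Fin (n + 1)) :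
    unitVec n b q ((lineOrder s).symm v) = if (v : ℕ) + q = c + 2 then 1 else 0 := by
  rw [unitVec]
  refine if_congr ?_ rfl rfl
  have h1 := h.lineOrder_symm v
  have hlen := h.length
  have := v.2
  split_ifs at h1 hlen ⊢ <;> omega

theorem unitVec_lineOrder_symm_eq_zero {q : ℕ} (hq : (c : ℕ) + 2 ≤ q + a)
    (hq' : q ≤ n + if b = true then 1 else 0) {v : Fin (n + 1)} (hv : (a : ℕ) < v) :
    unitVec n b q ((lineOrder s).symm v) = 0 := by
  rw [unitVec]
  refine if_neg ?_
  have h1 := h.lineOrder_symm v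
  have hlen := h.length
  have := v.2
  have hac := Fin.le_def.1 h.le
  split_ifs at h1 hlen hq' ⊢ <;> omega

theorem sum_unitVec_lineOrder_symm (v : Fin (n + 1)) :
    ∑ q ∈ Finset.Icc ((c : ℕ) - a + 2) (n + if b = true then 1 else 0),
      unitVec n b q ((lineOrder s).symm v) = if (v : ℕ) ≤ a then 1 else 0 := by
  have hac := Fin.le_def.1 h.le
  by_cases hv : (v : ℕ) ≤ a
  · rw [if_pos hv]
    have h1 := h.lineOrder_symm v
    have hlen := h.length
    have := v.2
    have hlt := ((lineOrder s).symm v).2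
    -- Exactly one unit vector in the range is nonzero at the position of `v`.
    rw [Finset.sum_eq_single_of_mem (if b = true then ((lineOrder s).symm v : ℕ) + 1
      else n + 1 - (lineOrder s).symm v)]
    · rw [unitVec, if_pos]
      split_ifs at h1 hlen ⊢ <;> omega
    · rw [Finset.mem_Icc]
      split_ifs at h1 hlen ⊢ <;> omega
    · intro q _ hne
      rw [unitVec, if_neg]
      split_ifs at h1 hlen hne ⊢ <;> omega
  · rw [if_neg hv]
    refine Finset.sum_eq_zero fun q hq => ?_
    rw [Finset.mem_Icc] at hq
    exact h.unitVec_lineOrder_symm_eq_zero (by omega) hq.2 (not_le.1 hv)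

/-- If `a = 0`, the initial block is vertex 0 alone, so the two definitions of the last column
agree. -/
theorem localCheckingMatrix_apply (hone : HasOneSuccession s ↔ (a : ℕ) = 0) (v : Fin (n + 1))
    (k : Fin ((c : ℕ) - a + 1)) :
    localCheckingMatrix s b ((c : ℕ) - a + 1) ((lineOrder s).symm v) k =
      if (k : ℕ) + a < c then
        (if (v : ℕ) = c + 1 then 1 else 0) - (if (v : ℕ) + k = c then 1 else 0)
      else ((a : ℝ) + 1) * (if (v : ℕ) = c + 1 then 1 else 0) - (if (v : ℕ) ≤ a then 1 else 0) := by
  have hac := Fin.le_def.1 h.le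
  have hk := k.2
  have hlen := h.length
  have hunit : unitVec n b 1 ((lineOrder s).symm v) = if (v : ℕ) = c + 1 then 1 else 0 := by
    rw [h.unitVec_lineOrder_symm le_rfl (by omega)]
    exact if_congr (by omega) rfl rfl
  have hsum := h.sum_unitVec_lineOrder_symm v
  simp only [localCheckingMatrix, of_apply, Pi.sub_apply, Pi.smul_apply, Finset.sum_apply, hunit,
    smul_eq_mul]
  by_cases h1 : (k : ℕ) + a < c
  · rw [if_pos (by omega), if_pos h1, h.unitVec_lineOrder_symm (by omega) (by omega)]
    congr 1
    exact if_congr (by omega) rfl rfl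
  · rw [if_neg (by omega), if_neg h1]
    by_cases h2 : (a : ℕ) = 0
    · rw [if_pos (hone.2 h2), ← hsum]
      have h3 : Finset.Icc ((c : ℕ) - a + 2) (n + if b = true then 1 else 0) =
          {(c : ℕ) - a + 1 + 1} := by
        ext q
        rw [Finset.mem_Icc, Finset.mem_singleton]
        split_ifs at hlen ⊢ <;> omega
      rw [h3, Finset.sum_singleton, h2]
      simp
    · rw [if_neg (fun h3 => h2 (hone.1 h3)), hsum]
      congr 2
      -- The size plus `δ` is `c + 2` in both cases, so the coefficient of the first unit vector is
      -- `a + 1`.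
      have h3 : (n + if b = true then 1 else 0) = (a : ℕ) + 1 + (c - a + 1) := by
        split_ifs at hlen ⊢ <;> omega
      have h4 : ((n : ℝ) + ((if b = true then 1 else 0 : ℕ) : ℝ)) =
          (a : ℝ) + 1 + ((c - a + 1 : ℕ) : ℝ) := by exact_mod_cast h3
      rw [h4]
      ring

end IsTail

/-! ### Full row rank in terms of run vectors -/

theorem Matrix.rank_eq_card_iff_forall_vecMul {m n K : Type*} [Fintype m] [Fintype n] [Field K]
    (M : Matrix m n K) : M.rank = Fintype.card m ↔ ∀ w, w ᵥ* M = 0 → w = 0 := by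
  rw [M.rank_eq_finrank_span_row, ← Set.finrank, eq_comm,
    ← linearIndependent_iff_card_eq_finrank_span, ← vecMul_injective_iff,
    ← coe_vecMulLinear, injective_iff_map_eq_zero]
  rfl

namespace IsRunVector

variable {n a c : ℕ} {u u' : Fin (n + 1) → ℝ}

theorem sub (h : IsRunVector a c u) (h' : IsRunVector a c u') : IsRunVector a c (u - u') :=
  ⟨fun v hv => by rw [Pi.sub_apply, Pi.sub_apply, h.const v hv, h'.const v hv],
    fun v hv => by rw [Pi.sub_apply, h.zero v hv, h'.zero v hv, sub_zero],
    by simp [h.sum, h'.sum]⟩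

/-- The values at `a, …, c` are free coordinates: constancy gives the earlier values and the zero
sum gives the one at `c + 1`. -/
theorem eq_zero (h : IsRunVector a c u) (hac : a ≤ c) (hc : c < n)
    (h0 : ∀ v : Fin (n + 1), a ≤ v → (v : ℕ) ≤ c → u v = 0) : u = 0 := by
  have h1 : ∀ v : Fin (n + 1), (v : ℕ) ≠ c + 1 → u v = 0 := by
    intro v hv
    rcases le_or_gt a v with h2 | h2
    · rcases le_or_gt (v : ℕ) c with h3 | h3
      · exact h0 v h2 h3
      · exact h.zero v (by omega)
    · rw [h.const v h2.le, ← h.const ⟨a, by omega⟩ le_rfl]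
      exact h0 _ le_rfl hac
  have h2 : u ⟨c + 1, by omega⟩ = 0 := by
    rw [← h.sum, Finset.sum_eq_single_of_mem _ (Finset.mem_univ _)]
    exact fun v _ hv => h1 v fun h3 => hv (Fin.ext h3)
  ext v
  by_cases hv : (v : ℕ) = c + 1
  · rw [show v = ⟨c + 1, by omega⟩ from Fin.ext hv, h2, Pi.zero_apply]
  · exact h1 v hv

theorem ext_of_forall (h : IsRunVector a c u) (h' : IsRunVector a c u') (hac : a ≤ c) (hc : c < n)
    (h0 : ∀ v : Fin (n + 1), a ≤ v → (v : ℕ) ≤ c → u v = u' v) : u = u' :=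
  sub_eq_zero.1 ((h.sub h').eq_zero hac hc fun v h1 h2 => sub_eq_zero.2 (h0 v h1 h2))

/-- Since `c + 1 ≤ m`, restriction and extension by zero match the run vectors of the two graphs
without changing their products with `B`. -/
theorem forall_castLE_iff {n m p : ℕ} (h : m ≤ n) {a c : ℕ} (hac : a ≤ c) (hc : c < m)
    (B : Matrix (Fin (n + 1)) (Fin p) ℝ) :
    (∀ u : Fin (m + 1) → ℝ, IsRunVector a c u →
        u ᵥ* B.submatrix (Fin.castLE (Nat.add_le_add_right h 1)) id = 0 → u = 0) ↔
      ∀ u : Fin (n + 1) → ℝ, IsRunVector a c u → u ᵥ* B = 0 → u = 0 := by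
  set e : Fin (m + 1) → Fin (n + 1) := Fin.castLE (Nat.add_le_add_right h 1) with he
  have hinj : Function.Injective e := Fin.castLE_injective _
  have hrange : ∀ v, v ∉ Set.range e → m + 1 ≤ (v : ℕ) := fun v hv => by
    by_contra! hlt
    exact hv ⟨⟨v, hlt⟩, rfl⟩
  have hsum : ∀ (u : Fin (n + 1) → ℝ), (∀ v : Fin (n + 1), c + 1 < (v : ℕ) → u v = 0) →
      ∀ f : Fin (n + 1) → ℝ, ∑ v, u (e v) * f (e v) = ∑ v, u v * f v := fun u hu f =>
    Fintype.sum_of_injective e hinj _ _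
      (fun v hv => by rw [hu v (by have := hrange v hv; omega), zero_mul]) fun _ => rfl
  have hmul : ∀ (u : Fin (n + 1) → ℝ), (∀ v : Fin (n + 1), c + 1 < (v : ℕ) → u v = 0) →
      (u ∘ e) ᵥ* B.submatrix e id = u ᵥ* B := fun u hu => funext fun x => hsum u hu fun v => B v x
  have hsum' : ∀ (u : Fin (n + 1) → ℝ), (∀ v : Fin (n + 1), c + 1 < (v : ℕ) → u v = 0) →
      ∑ v, (u ∘ e) v = ∑ v, u v := fun u hu => by simpa using hsum u hu fun _ => 1
  constructor
  · intro hall u hu hB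
    have h0 : u ∘ e = 0 := hall (u ∘ e) ⟨fun v hv => hu.const (e v) hv,
      fun v hv => hu.zero (e v) hv, by rw [hsum' u hu.zero, hu.sum]⟩ (by rw [hmul u hu.zero, hB])
    ext v
    by_cases hv : v ∈ Set.range e
    · obtain ⟨v, rfl⟩ := hv
      exact congrFun h0 v
    · exact hu.zero v (by have := hrange v hv; omega)
  · intro hall u hu hB
    let u' : Fin (n + 1) → ℝ := fun v => if h : (v : ℕ) < m + 1 then u ⟨v, h⟩ else 0
    have hu' : u' ∘ e = u := funext fun v => dif_pos v.2
    have hz : ∀ v : Fin (n + 1), c + 1 < (v : ℕ) → u' v = 0 := fun v hv => by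
      simp only [u']
      split_ifs with h1
      · exact hu.zero _ hv
      · rfl
    have h0 : u' = 0 := by
      refine hall u' ⟨fun v hv => ?_, hz, ?_⟩ ?_
      · have h1 : (v : ℕ) < m + 1 := by omega
        exact (dif_pos h1).trans (hu.const ⟨v, h1⟩ hv)
      · rw [← hsum' u' hz, hu', hu.sum]
      · rw [← hmul u' hz, hu', hB]
    rw [← hu', h0]
    rfl

end IsRunVector

namespace IsTail

variable {n : ℕ} {s : Fin n → Bool} {b : Bool} {a c : Fin n} (h : IsTail s b a c)
  (hone : HasOneSuccession s ↔ (a : ℕ) = 0)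
include h hone

theorem isRunVector_localCheckingMatrix_mulVec (w : Fin ((c : ℕ) - a + 1) → ℝ) :
    IsRunVector a c
      ((localCheckingMatrix s b ((c : ℕ) - a + 1) *ᵥ w) ∘ (lineOrder s).symm) := by
  have hac := Fin.le_def.1 h.le
  refine ⟨fun v hv => ?_, fun v hv => ?_, ?_⟩
  · simp only [Function.comp_apply, mulVec, dotProduct]
    refine Finset.sum_congr rfl fun k _ => ?_
    rw [h.localCheckingMatrix_apply hone, h.localCheckingMatrix_apply hone]
    congr 1
    rw [Fin.val_zero]
    split_ifs <;> first | rfl | contradiction | omega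
  · simp only [Function.comp_apply, mulVec, dotProduct]
    refine Finset.sum_eq_zero fun k _ => ?_
    rw [h.localCheckingMatrix_apply hone]
    split_ifs <;> first | omega | simp
  · simp only [Function.comp_apply, mulVec, dotProduct]
    rw [Finset.sum_comm]
    refine Finset.sum_eq_zero fun k _ => ?_
    rw [← Finset.sum_mul]
    refine mul_eq_zero_of_left ?_ _
    have h1 : ∑ v : Fin (n + 1), (if (v : ℕ) = c + 1 then (1 : ℝ) else 0) = 1 := by
      rw [Finset.sum_eq_single_of_mem c.succ (Finset.mem_univ _)]
      · simp
      · exact fun v _ hv => if_neg fun h2 => hv (Fin.ext (by simpa using h2))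
    have h2 : ∑ v : Fin (n + 1), (if (v : ℕ) ≤ a then (1 : ℝ) else 0) = a + 1 := by
      rw [← Finset.sum_filter, Finset.sum_const, nsmul_one]
      have : (Finset.univ.filter fun v : Fin (n + 1) => (v : ℕ) ≤ a) = Finset.Iic a.castSucc := by
        ext v; simp [Fin.le_def]
      rw [this, Fin.card_Iic]
      simp
    simp only [h.localCheckingMatrix_apply hone]
    split_ifs with hk
    · have h3 : ∑ v : Fin (n + 1), (if (v : ℕ) + k = c then (1 : ℝ) else 0) = 1 := by
        rw [Finset.sum_eq_single_of_mem ⟨(c : ℕ) - k, by omega⟩ (Finset.mem_univ _)]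
        · exact if_pos (by simp only; omega)
        · exact fun v _ hv => if_neg fun h2 => hv (Fin.ext (by simp only; omega))
      rw [Finset.sum_sub_distrib, h1, h3, sub_self]
    · rw [Finset.sum_sub_distrib, ← Finset.mul_sum, h1, h2, mul_one, sub_self]

/-- At vertex `c - k` only column `k` is nonzero, with entry `-1`. So the columns are, up to sign,
the basis dual to the coordinates at `a, …, c`. -/
theorem localCheckingMatrix_mulVec_apply (w : Fin ((c : ℕ) - a + 1) → ℝ)
    (k : Fin ((c : ℕ) - a + 1)) {v : Fin (n + 1)} (hv : (v : ℕ) + k = c) :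
    (localCheckingMatrix s b ((c : ℕ) - a + 1) *ᵥ w) ((lineOrder s).symm v) = - w k := by
  have hac := Fin.le_def.1 h.le
  have hk := k.2
  rw [mulVec, dotProduct, Finset.sum_eq_single_of_mem k (Finset.mem_univ _)]
  · rw [h.localCheckingMatrix_apply hone]
    split_ifs <;> first | omega | simp
  · intro k' _ hne
    have hne' : (k' : ℕ) ≠ k := fun h1 => hne (Fin.ext h1)
    have hk' := k'.2
    rw [h.localCheckingMatrix_apply hone]
    split_ifs <;> first | omega | simp

theorem rank_localCheckingMatrix_transpose_mul {p : ℕ} (B : Matrix (Fin (n + 1)) (Fin p) ℝ) :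
    ((localCheckingMatrix s b ((c : ℕ) - a + 1))ᵀ * B).rank = (c : ℕ) - a + 1 ↔
      ∀ u : Fin (n + 1) → ℝ, IsRunVector a c u →
        u ᵥ* B.submatrix (lineOrder s).symm id = 0 → u = 0 := by
  have hac := Fin.le_def.1 h.le
  have hmul : ∀ w, ((localCheckingMatrix s b ((c : ℕ) - a + 1) *ᵥ w) ∘ (lineOrder s).symm) ᵥ*
      B.submatrix (lineOrder s).symm id =
        w ᵥ* ((localCheckingMatrix s b ((c : ℕ) - a + 1))ᵀ * B) := by
    intro w
    rw [submatrix_vecMul_equiv, ← vecMul_vecMul, vecMul_transpose]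
    ext x
    simp [Function.comp_def]
  have hrank := rank_eq_card_iff_forall_vecMul ((localCheckingMatrix s b ((c : ℕ) - a + 1))ᵀ * B)
  rw [Fintype.card_fin] at hrank
  rw [hrank]
  constructor
  · intro hall u hu hB
    have hw : u = (localCheckingMatrix s b ((c : ℕ) - a + 1) *ᵥ
        fun k => - u ⟨(c : ℕ) - k, by omega⟩) ∘ (lineOrder s).symm := by
      refine hu.ext_of_forall (h.isRunVector_localCheckingMatrix_mulVec hone _) hac c.2
        fun v h1 h2 => ?_
      rw [Function.comp_apply, h.localCheckingMatrix_mulVec_apply hone _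
        ⟨(c : ℕ) - v, by omega⟩ (by simp only; omega), neg_neg]
      congr 1
      exact Fin.ext (by simp only; omega)
    have h0 := hall (fun k => - u ⟨(c : ℕ) - k, by omega⟩) (by rw [← hmul, ← hw, hB])
    rw [hw, h0, mulVec_zero]
    rfl
  · intro hall w hw
    have h0 := hall _ (h.isRunVector_localCheckingMatrix_mulVec hone w) (by rw [hmul, hw])
    ext k
    have hk := k.2
    have h1 := h.localCheckingMatrix_mulVec_apply hone w k
      (v := ⟨(c : ℕ) - k, by omega⟩) (by simp only; omega)
    have h2 : (localCheckingMatrix s b ((c : ℕ) - a + 1) *ᵥ w)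
      ((lineOrder s).symm ⟨(c : ℕ) - k, by omega⟩) = 0 := congrFun h0 _
    rw [h2] at h1
    simpa using h1.symm

end IsTail

theorem ThresholdControl.IsSuccession.rank_localCheckingMatrix_transpose_mul {n m p : ℕ} {s : Fin n → Bool}
    (h : m ≤ n) {b : Bool} {i j : Fin m}
    (hij : IsSuccession s b (Fin.castLE h i) (Fin.castLE h j))
    (hm : m = if b = true then (j : ℕ) + 1 else j + 2)
    (hl : ∀ l : Fin n, (l : ℕ) = j + 1 → (l : ℕ) < m → s l = true)
    (B : Matrix (Fin (n + 1)) (Fin p) ℝ) :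
    ((localCheckingMatrix (substring s h) b ((j : ℕ) - i + 1))ᵀ *
        localControlMatrix s h B).rank = (j : ℕ) - i + 1 ↔
      ∀ u : Fin (n + 1) → ℝ, IsRunVector i j u →
        u ᵥ* B.submatrix (lineOrder s).symm id = 0 → u = 0 := by
  have htail : IsTail (substring s h) b i j :=
    ⟨hij.le, fun l h1 h2 => hij.eq _ h1 h2, hm, fun l h1 => hl _ h1 l.2⟩
  have hlast := hij.isLastSuccession_substring h (by split_ifs at hm <;> omega)
  rw [htail.rank_localCheckingMatrix_transpose_mul hlast.hasOneSuccession_iff,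
    ← IsRunVector.forall_castLE_iff h (Fin.le_def.1 htail.le) j.2]
  have : (localControlMatrix s h B).submatrix (lineOrder (substring s h)).symm id =
      (B.submatrix (lineOrder s).symm id).submatrix
        (Fin.castLE (Nat.add_le_add_right h 1)) id := by
    ext v x
    simp [localControlMatrix]
  rw [this]

/-- Essential substrings match successions of the whole string: a succession of 1 ends its
substring, and one of 0 is followed by a 1 because the string ends in 1. -/
theorem forall_isEssential_rank_iff {n p : ℕ} {s : Fin n → Bool}
    (hs : ∃ l : Fin n, (l : ℕ) + 1 = n ∧ s l = true) (B : Matrix (Fin (n + 1)) (Fin p) ℝ) :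
    (∀ (m : ℕ) (h : m ≤ n), IsEssential s m →
        ∀ (b : Bool) (i j : Fin m), IsLastSuccession (substring s h) b i j →
          ((localCheckingMatrix (substring s h) b ((j : ℕ) - i + 1))ᵀ *
            localControlMatrix s h B).rank = (j : ℕ) - i + 1) ↔
      ∀ (b : Bool) (a c : Fin n), IsSuccession s b a c → ∀ u : Fin (n + 1) → ℝ,
        IsRunVector a c u → u ᵥ* B.submatrix (lineOrder s).symm id = 0 → u = 0 := by
  constructor
  · intro hall b a c hac
    have hle := Fin.le_def.1 hac.le
    have hc := c.2
    cases b with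
    | true =>
      have h : (c : ℕ) + 1 ≤ n := c.2
      have hij : IsSuccession s true (Fin.castLE h ⟨a, by omega⟩) (Fin.castLE h ⟨c, by omega⟩) := hac
      exact (hij.rank_localCheckingMatrix_transpose_mul h rfl (fun l h1 h2 => by simp at h1; omega)
        B).1 (hall _ h ⟨c, rfl, hac.eq c hac.le le_rfl, Or.inr ⟨a, hac⟩⟩ _ _ _
          (hij.isLastSuccession_substring h (by simp)))
    | false =>
      have hsc := hac.eq c hac.le le_rfl
      obtain ⟨l, hln, hsl⟩ := hs
      have hlc : (l : ℕ) ≠ c := fun h => by rw [Fin.ext h, hsc] at hsl; cases hsl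
      have h : (c : ℕ) + 2 ≤ n := by omega
      have hst : ∀ t : Fin n, (t : ℕ) = c + 1 → s t = true := fun t ht => by
        simpa using hac.right t ht
      have hij : IsSuccession s false (Fin.castLE h ⟨a, by omega⟩) (Fin.castLE h ⟨c, by omega⟩) :=
        hac
      exact (hij.rank_localCheckingMatrix_transpose_mul h rfl (fun t ht _ => hst t ht) B).1
        (hall _ h ⟨⟨c + 1, by omega⟩, rfl, hst _ rfl, Or.inl ⟨a, c, hac, rfl⟩⟩ _ _ _
          (hij.isLastSuccession_substring h (by simp)))
  · rintro hall m h ⟨t, rfl, hst, ⟨i', j', hij, hjt⟩ | ⟨i', hij⟩⟩ b i j hlast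
    · have hle := Fin.le_def.1 hij.le
      have hij' : IsSuccession s false (Fin.castLE h ⟨i', by omega⟩) (Fin.castLE h ⟨j', by omega⟩) :=
        hij
      obtain ⟨rfl, rfl, rfl⟩ :=
        hlast.unique (hij'.isLastSuccession_substring h (by simp only; omega))
      refine (hij'.rank_localCheckingMatrix_transpose_mul h ?_ (fun l h1 _ => ?_) B).2
        (hall _ _ _ hij)
      · simp only [Bool.false_eq_true, if_false]; omega
      · rwa [show l = t from Fin.ext (by simp only at h1; omega)]
    · have hle := Fin.le_def.1 hij.le
      have hij' : IsSuccession s true (Fin.castLE h ⟨i', by omega⟩) (Fin.castLE h ⟨t, by omega⟩) :=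
        hij
      obtain ⟨rfl, rfl, rfl⟩ :=
        hlast.unique (hij'.isLastSuccession_substring h (by simp only; omega))
      exact (hij'.rank_localCheckingMatrix_transpose_mul h rfl
        (fun l h1 h2 => by simp only at h1; omega) B).2 (hall _ _ _ hij)

/-! ### Eigenvectors of the threshold Laplacian and the conclusion -/

theorem isControllable_neg_thresholdLaplacian_iff {n p : ℕ} (s : Fin n → Bool)
    (B : Matrix (Fin (n + 1)) (Fin p) ℝ) :
    IsControllable (-thresholdLaplacian s) B ↔ ∀ (μ : ℝ) (u : Fin (n + 1) → ℝ),
      (thresholdGraph s).lapMatrix ℝ *ᵥ u = μ • u →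
        u ᵥ* B.submatrix (lineOrder s).symm id = 0 → u = 0 := by
  have hsymm : (-thresholdLaplacian s).IsSymm := by
    refine IsSymm.neg ?_
    rw [thresholdLaplacian]
    exact (SimpleGraph.isSymm_lapMatrix ℝ _).submatrix _
  rw [isControllable_iff_of_isSymm hsymm]
  constructor
  · intro hall μ u hu hB
    have h1 := hall (-μ) (u ∘ lineOrder s) (by
      rw [thresholdLaplacian, neg_mulVec, submatrix_mulVec_equiv, Function.comp_assoc,
        Equiv.self_comp_symm, Function.comp_id, hu, neg_smul]
      rfl) (by
      rw [submatrix_vecMul_equiv] at hB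
      simpa using hB)
    rw [← Function.comp_id u, ← Equiv.self_comp_symm (lineOrder s), ← Function.comp_assoc, h1]
    rfl
  · intro hall μ w hw hB
    have h1 := hall (-μ) (w ∘ (lineOrder s).symm) (by
      rw [thresholdLaplacian, neg_mulVec, submatrix_mulVec_equiv, neg_eq_iff_eq_neg] at hw
      have := congrArg (fun x => x ∘ (lineOrder s).symm) hw
      simp only [Function.comp_assoc, Equiv.self_comp_symm, Function.comp_id] at this
      rw [this, neg_smul]
      rfl) (by
      rw [submatrix_vecMul_equiv]
      simp only [Function.comp_assoc, Equiv.symm_symm, Equiv.symm_comp_self, Function.comp_id, hB])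
    rw [← Function.comp_id w, ← Equiv.symm_comp_self (lineOrder s), ← Function.comp_assoc, h1]
    rfl

/-- All step vectors not orthogonal to `u` have eigenvalue `μ`, so their entries lie in one maximal
run. Such a run fails to be a succession only if it is a single entry after the start. -/
theorem eigenvector_cases {n : ℕ} {s : Fin n → Bool}
    (hs : ∃ l : Fin n, (l : ℕ) + 1 = n ∧ s l = true) {u : Fin (n + 1) → ℝ} {μ : ℝ}
    (hu : (thresholdGraph s).lapMatrix ℝ *ᵥ u = μ • u) :
    (∀ v, u v = u 0) ∨ ∃ a c : Fin n, IsRunVector a c u ∧ ((a : ℕ) = 0 ∨ a < c →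
      ∃ b, IsSuccession s b a c) ∧ a ≤ c := by
  by_cases hall : ∀ l, stepVector l ⬝ᵥ u = 0
  · exact Or.inl fun v => eq_apply_zero_of_stepVector_dotProduct (a := n) (fun l _ => hall l) v
      (Nat.lt_succ_iff.1 v.2)
  · obtain ⟨l, hl⟩ := not_forall.1 hall
    have hμ := (stepVector_dotProduct_eigenvector hu l).resolve_left hl
    have hsum : ∑ v, u v = 0 := by
      refine sum_eq_zero_of_eigenvector _ ?_ hu
      rw [← hμ]
      exact_mod_cast runEigenvalue_ne_zero hs l
    obtain ⟨a, c, hal, hlc, heq, hleft, hright⟩ := exists_maximal_run s l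
    have hal' := Fin.le_def.1 hal
    have hlc' := Fin.le_def.1 hlc
    have heig : ∀ x, stepVector x ⬝ᵥ u ≠ 0 → runEigenvalue s l = runEigenvalue s x := fun x hx => by
      have := hμ.trans ((stepVector_dotProduct_eigenvector hu x).resolve_left hx).symm
      exact_mod_cast this
    refine Or.inr ⟨a, c, ⟨eq_apply_zero_of_stepVector_dotProduct fun x hx => ?_,
      apply_eq_zero_of_stepVector_dotProduct hsum fun x hx => ?_, hsum⟩, fun h =>
        ⟨s l, hal.trans hlc, heq, hleft, hright, fun h1 => h.resolve_left h1.ne'⟩, hal.trans hlc⟩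
    · by_contra hne
      have hxl : x < l := Fin.lt_def.2 (by omega)
      -- The entry just before the run lies between `x` and `l`, so it would equal `s l`, against
      -- maximality.
      let y : Fin n := ⟨a - 1, by omega⟩
      have h1 := eq_of_runEigenvalue_eq hxl (heig x hne).symm (x := y)
        (Fin.le_def.2 (by simp only [y]; omega)) (Fin.le_def.2 (by simp only [y]; omega))
      have h2 := eq_of_runEigenvalue_eq hxl (heig x hne).symm (x := l) hxl.le le_rfl
      exact hleft y (by simp only [y]; omega) (h1.trans h2.symm)
    · by_contra hne
      have hlx : l < x := Fin.lt_def.2 (by omega)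
      let y : Fin n := ⟨c + 1, by omega⟩
      exact hright y rfl (eq_of_runEigenvalue_eq hlx (heig x hne)
        (Fin.le_def.2 (by simp only [y]; omega)) (Fin.le_def.2 (by simp only [y]; omega)))

/-- The vector `e₀ - e₁` is a run vector of the first succession, whatever its length, so `B` must
not kill it. -/
theorem exists_ne_row_zero_of_forall_isSuccession {n p : ℕ} {s : Fin n → Bool}
    {B : Matrix (Fin (n + 1)) (Fin p) ℝ}
    (hall : ∀ (b : Bool) (a c : Fin n), IsSuccession s b a c → ∀ u : Fin (n + 1) → ℝ,
      IsRunVector a c u → u ᵥ* B = 0 → u = 0) {l : Fin n} (hl : (l : ℕ) = 0) :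
    ∃ x, B l.succ x ≠ B 0 x := by
  by_contra! heq
  obtain ⟨b, a, c, ha, hac⟩ := exists_isSuccession_zero (lt_of_le_of_lt (Nat.zero_le _) l.2) s
  have hrun : IsRunVector a c (stepVector l) := by
    have h := isRunVector_stepVector l
    exact ⟨fun v hv => h.const v (by omega), fun v hv => h.zero v (by omega), h.sum⟩
  have h0 := hall b a c hac _ hrun (by
    ext x
    have h1 : (stepVector l ᵥ* B) x = stepVector l ⬝ᵥ fun v => B v x := rfl
    have h2 : (Finset.univ.filter fun v : Fin (n + 1) => (v : ℕ) ≤ l) = {0} := by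
      ext v
      simp only [Finset.mem_filter, Finset.mem_univ, true_and, Finset.mem_singleton, hl,
        Fin.ext_iff, Fin.val_zero, Nat.le_zero]
    rw [h1, stepVector_dotProduct, h2, Finset.sum_singleton, hl, heq]
    simp)
  have h1 := congrFun h0 0
  simp [stepVector] at h1

theorem eq_zero_of_const_of_vecMul {n p : ℕ} {B : Matrix (Fin (n + 1)) (Fin p) ℝ}
    (hB : ∀ r c, 0 ≤ B r c) (hne : ∃ r c, B r c ≠ 0) {u : Fin (n + 1) → ℝ} (hu : ∀ v, u v = u 0)
    (huB : u ᵥ* B = 0) : u = 0 := by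
  obtain ⟨r, x, hx⟩ := hne
  have h1 : ∑ v, u v * B v x = 0 := congrFun huB x
  simp only [hu, ← Finset.mul_sum] at h1
  rcases mul_eq_zero.1 h1 with h2 | h2
  · ext v
    rw [hu, h2, Pi.zero_apply]
  · exact absurd ((Finset.sum_eq_zero_iff_of_nonneg fun v _ => hB v x).1 h2 r (Finset.mem_univ _)) hx

/-- The run vectors of one entry are the multiples of its step vector. If that is orthogonal to a
0/1 column, the mean of the first `a + 1` entries is 0 or 1, so these entries all agree; the column
`x` excludes this. -/
theorem eq_zero_of_isRunVector_self_of_vecMul {n p : ℕ} {B : Matrix (Fin (n + 1)) (Fin p) ℝ}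
    (hB : ∀ r c, B r c = 0 ∨ B r c = 1) {a : Fin n}
    (hne : ∃ (v : Fin (n + 1)) (x : Fin p), (v : ℕ) ≤ a ∧ B v x ≠ B 0 x) {u : Fin (n + 1) → ℝ}
    (hu : IsRunVector a a u) (huB : u ᵥ* B = 0) : u = 0 := by
  obtain ⟨r, x, hr, hx⟩ := hne
  have hstep := isRunVector_stepVector a
  have hstep0 : stepVector a 0 = 1 := by simp [stepVector]
  have hsmul : u = u 0 • stepVector a := by
    refine hu.ext_of_forall ⟨fun v hv => ?_, fun v hv => ?_, ?_⟩ le_rfl a.2 fun v h1 h2 => ?_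
    · rw [Pi.smul_apply, Pi.smul_apply, hstep.const v hv]
    · rw [Pi.smul_apply, hstep.zero v hv, smul_zero]
    · simp only [Pi.smul_apply, ← Finset.smul_sum, hstep.sum, smul_zero]
    · rw [Pi.smul_apply, hu.const v h2, hstep.const v h2, hstep0, smul_eq_mul, mul_one]
  have h1 : u ⬝ᵥ (fun v => B v x) = 0 := congrFun huB x
  rw [hsmul, smul_dotProduct, smul_eq_mul, stepVector_dotProduct] at h1
  rcases mul_eq_zero.1 h1 with h2 | h2
  · rw [hsmul, h2, zero_smul]
  · exfalso
    have hmem : ∀ v : Fin (n + 1), (v : ℕ) ≤ a →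
        v ∈ Finset.univ.filter fun v : Fin (n + 1) => (v : ℕ) ≤ a := fun v hv => by simpa using hv
    have hcard : (Finset.univ.filter fun v : Fin (n + 1) => (v : ℕ) ≤ a).card = (a : ℕ) + 1 := by
      have : (Finset.univ.filter fun v : Fin (n + 1) => (v : ℕ) ≤ a) = Finset.Iic a.castSucc := by
        ext v; simp [Fin.le_def]
      rw [this, Fin.card_Iic]
      simp
    rcases hB a.succ x with h3 | h3
    · rw [h3, mul_zero, sub_zero, Finset.sum_eq_zero_iff_of_nonneg fun v _ => by
        rcases hB v x with h | h <;> simp [h]] at h2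
      exact hx ((h2 r (hmem r hr)).trans (h2 0 (hmem 0 (Nat.zero_le _))).symm)
    · have h4 : ∑ v ∈ Finset.univ.filter fun v : Fin (n + 1) => (v : ℕ) ≤ a, (1 - B v x) = 0 := by
        rw [Finset.sum_sub_distrib, Finset.sum_const, hcard, nsmul_eq_mul]
        rw [h3] at h2
        push_cast
        linarith
      rw [Finset.sum_eq_zero_iff_of_nonneg fun v _ => by
        rcases hB v x with h | h <;> simp [h]] at h4
      have h5 := h4 r (hmem r hr)
      have h6 := h4 0 (hmem 0 (Nat.zero_le _))
      exact hx (by linarith)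

theorem mainTheorem2 (n p : ℕ) (hn : 1 ≤ n) (s : Fin n → Bool)
    (hs : (thresholdGraph s).Connected)
    (B : Matrix (Fin (n + 1)) (Fin p) ℝ) (hB : ∀ r c, B r c = 0 ∨ B r c = 1) :
    IsControllable (-thresholdLaplacian s) B ↔
      ∀ (m : ℕ) (h : m ≤ n), IsEssential s m →
        ∀ (b : Bool) (i j : Fin m), IsLastSuccession (substring s h) b i j →
          ((localCheckingMatrix (substring s h) b ((j : ℕ) - i + 1))ᵀ *
            localControlMatrix s h B).rank = (j : ℕ) - i + 1 := by
  have hlast := exists_last_eq_true_of_connected hn hs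
  rw [isControllable_neg_thresholdLaplacian_iff, forall_isEssential_rank_iff hlast]
  have hB' : ∀ r c, B.submatrix (lineOrder s).symm id r c = 0 ∨
      B.submatrix (lineOrder s).symm id r c = 1 := fun r c => hB _ c
  generalize B.submatrix (lineOrder s).symm id = B' at hB' ⊢
  constructor
  · exact fun hall b a c hac u hu huB => hall _ u (hu.lapMatrix_mulVec hac.le hac.eq) huB
  · intro hall μ u hu huB
    let l : Fin n := ⟨0, hn⟩
    obtain ⟨x, hx⟩ := exists_ne_row_zero_of_forall_isSuccession hall (l := l) rfl
    rcases eigenvector_cases hlast hu with hconst | ⟨a, c, hrun, hsucc, hac⟩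
    · refine eq_zero_of_const_of_vecMul (fun r c => ?_) ?_ hconst huB
      · rcases hB' r c with h | h <;> simp [h]
      · by_contra! h
        exact hx ((h _ _).trans (h _ _).symm)
    · by_cases h : (a : ℕ) = 0 ∨ a < c
      · obtain ⟨b, hb⟩ := hsucc h
        exact hall b a c hb u hrun huB
      · rw [not_or] at h
        obtain rfl : a = c := le_antisymm hac (not_lt.1 h.2)
        -- Here `a ≥ 1`, so vertices 0 and 1, whose rows differ, are both among the first `a + 1`.
        exact eq_zero_of_isRunVector_self_of_vecMul hB'
          ⟨l.succ, x, by simp only [l, Fin.val_succ]; omega, hx⟩ hrun huB
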